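/- For $k\in\mathbb{N}=\{0,1,2,\dots\}$ let $$f_k=\sum_{l=0}^k\binom{k}{l}^3,\qquad g_k=\sum_{l=0}^k\binom{k}{l}^2\binom{2l}{l},\qquad A_k=\sum_{l=0}^k\binom{k}{l}^2\binom{k+l}{l}^2$$ (the $f_k$ are the Franel numbers and the $A_k$ the Apéry numbers), and let $\left(\frac{\cdot}{3}\right)$ denote the Legendre symbol modulo $3$. (i) For every integer $n>1$, $$\sum_{k=0}^{n-1}(12k^4+25k^3+21k^2+6k)(-1)^kf_k\equiv 0\pmod{4n^2(n-1)},$$ and for every odd prime $p$, $$\sum_{k=0}^{p-1}(12k^4+25k^3+21k^2+6k)(-1)^kf_k\equiv -4p^3\pmod{p^4}.$$ (ii) For every integer $n\ge 1$, $$\sum_{k=0}^{n-1}(12k^3+34k^2+30k+9)g_k\equiv 0\pmod{3n^3},$$ and for every odd prime $p$, $$\sum_{k=0}^{p-1}(12k^3+34k^2+30k+9)g_k\equiv \frac{3p^3}{2}\left(1+3\left(\frac{p}{3}\right)\right)\pmod{p^4},$$ where for rational $a,b$ the congruence $a\equiv b\pmod{p^4}$ means that $a-b=p^4c$ for a rational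 number $c$ whose denominator is not divisible by $p$. (iii) For every integer $n\ge 1$, $$\sum_{k=0}^{n-1}(18k^5+45k^4+46k^3+24k^2+7k+1)(-1)^kA_k\equiv 0\pmod{n^4},$$ and for every prime $p>3$, $$\sum_{k=0}^{p-1}(18k^5+45k^4+46k^3+24k^2+7k+1)(-1)^kA_k\equiv -2p^4+3p^5\pmod{p^7}.$$ -/

import Mathlib

/-- The Franel numbers `f_k = ∑_{l=0}^{k} C(k,l)^3`. -/
def franel (k : ℕ) : ℤ :=
  ∑ l ∈ Finset.range (k + 1), (k.choose l : ℤ) ^ 3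

/-- The numbers `g_k = ∑_{l=0}^{k} C(k,l)^2 C(2l,l)`. -/
def gNum (k : ℕ) : ℤ :=
  ∑ l ∈ Finset.range (k + 1), (k.choose l : ℤ) ^ 2 * ((2 * l).choose l : ℤ)

/-- The Apéry numbers `A_k = ∑_{l=0}^{k} C(k,l)^2 C(k+l,l)^2`. -/
def apery (k : ℕ) : ℤ :=
  ∑ l ∈ Finset.range (k + 1), (k.choose l : ℤ) ^ 2 * ((k + l).choose l : ℤ) ^ 2

/-- The congruence `a ≡ b (mod m)` between rational numbers: `a - b` is `m` times a rational
number whose reduced denominator is coprime to `m`. -/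
def RatModEq (m : ℕ) (a b : ℚ) : Prop :=
  ∃ c : ℚ, c.den.Coprime m ∧ a - b = (m : ℚ) * c

/-! ### Ratios of neighbouring binomial coefficients -/

theorem cast_choose_eq_div_mul_choose_succ (n k : ℕ) :
    (n.choose k : ℚ) = (n + 1 - k) / (n + 1) * ((n + 1).choose k : ℚ) := by
  have hn : (n : ℚ) + 1 ≠ 0 := by positivity
  rcases le_or_gt k (n + 1) with h | h
  · have e : (n.choose k * (n + 1) : ℚ) = (n + 1).choose k * ((n + 1 - k : ℕ) : ℚ) := by
      exact_mod_cast Nat.choose_mul_succ_eq n k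
    rw [Nat.cast_sub h] at e
    push_cast at e
    field_simp
    linear_combination e
  · rw [Nat.choose_eq_zero_of_lt h, Nat.choose_eq_zero_of_lt (by omega)]
    simp

theorem cast_choose_succ_right (n k : ℕ) :
    (n.choose (k + 1) : ℚ) = (n - k) / (k + 1) * (n.choose k : ℚ) := by
  have hk : (k : ℚ) + 1 ≠ 0 := by positivity
  rcases le_or_gt k n with h | h
  · have e : (n.choose (k + 1) * (k + 1) : ℚ) = n.choose k * ((n - k : ℕ) : ℚ) := by
      exact_mod_cast Nat.choose_succ_right_eq n k
    rw [Nat.cast_sub h] at e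
    field_simp
    linear_combination e
  · rw [Nat.choose_eq_zero_of_lt h, Nat.choose_eq_zero_of_lt (by omega)]
    simp

theorem cast_choose_succ_add (n k : ℕ) :
    ((n + 1 + k).choose k : ℚ) = (n + 1 + k) / (n + 1) * ((n + k).choose k : ℚ) := by
  have h := cast_choose_eq_div_mul_choose_succ (n + k) k
  have hn : (n : ℚ) + 1 ≠ 0 := by positivity
  rw [show n + k + 1 = n + 1 + k by ring] at h
  rw [h]
  push_cast
  have : (n : ℚ) + k + 1 ≠ 0 := by positivity
  field_simp
  ring

theorem cast_choose_add_succ (n k : ℕ) :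
    ((n + (k + 1)).choose (k + 1) : ℚ) = (n + k + 1) / (k + 1) * ((n + k).choose k : ℚ) := by
  have hk : (k : ℚ) + 1 ≠ 0 := by positivity
  have e : ((n + k : ℕ) + 1 : ℚ) * (n + k).choose k = (n + k + 1).choose (k + 1) * (k + 1) := by
    exact_mod_cast Nat.add_one_mul_choose_eq (n + k) k
  rw [show n + (k + 1) = n + k + 1 by ring]
  push_cast at e
  field_simp
  linear_combination -e

theorem cast_centralBinom_succ (k : ℕ) :
    ((k : ℚ) + 1) * ((2 * (k + 1)).choose (k + 1) : ℚ)
      = 2 * (2 * k + 1) * ((2 * k).choose k : ℚ) := by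
  have := Nat.succ_mul_centralBinom_succ k
  simp only [Nat.centralBinom] at this
  exact_mod_cast this

/-! ### Three-term recurrences -/

theorem sum_range_succ_eq_of_eq_zero {N n : ℕ} (h : n ≤ N) (t : ℕ → ℤ)
    (ht : ∀ l, n < l → t l = 0) :
    ∑ l ∈ Finset.range (N + 1), t l = ∑ l ∈ Finset.range (n + 1), t l := by
  symm
  apply Finset.sum_subset
  · exact Finset.range_mono (by omega)
  · intro x _ hx
    exact ht x (by simpa using hx)

theorem franel_eq_sum_range {N n : ℕ} (h : n ≤ N) :
    franel n = ∑ l ∈ Finset.range (N + 1), (n.choose l : ℤ) ^ 3 := by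
  rw [sum_range_succ_eq_of_eq_zero h, franel]
  intro l hl
  simp [Nat.choose_eq_zero_of_lt hl]

theorem gNum_eq_sum_range {N n : ℕ} (h : n ≤ N) :
    gNum n = ∑ l ∈ Finset.range (N + 1), (n.choose l : ℤ) ^ 2 * ((2 * l).choose l : ℤ) := by
  rw [sum_range_succ_eq_of_eq_zero h, gNum]
  intro l hl
  simp [Nat.choose_eq_zero_of_lt hl]

theorem apery_eq_sum_range {N n : ℕ} (h : n ≤ N) :
    apery n = ∑ l ∈ Finset.range (N + 1),
      (n.choose l : ℤ) ^ 2 * ((n + l).choose l : ℤ) ^ 2 := by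
  rw [sum_range_succ_eq_of_eq_zero h, apery]
  intro l hl
  simp [Nat.choose_eq_zero_of_lt hl]

theorem franel_recurrence (m : ℕ) :
    ((m : ℤ) + 2) ^ 2 * franel (m + 2)
      = (7 * (m + 1) ^ 2 + 7 * (m + 1) + 2) * franel (m + 1) + 8 * (m + 1) ^ 2 * franel m := by
  let G : ℕ → ℚ := fun k =>
    (4 * (k : ℚ) ^ 3 - (12 + 18 * (m + 1)) * k ^ 2 + (12 + 39 * (m + 1) + 27 * (m + 1) ^ 2) * k
      - (4 + 22 * (m + 1) + 32 * (m + 1) ^ 2 + 14 * (m + 1) ^ 3)) * k ^ 3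
      * ((m + 2).choose k : ℚ) ^ 3 / ((m + 1) * (m + 2) ^ 3)
  have key : ∀ k : ℕ, ((m : ℚ) + 2) ^ 2 * ((m + 2).choose k : ℚ) ^ 3
      - (7 * (m + 1) ^ 2 + 7 * (m + 1) + 2) * ((m + 1).choose k : ℚ) ^ 3
      - 8 * (m + 1) ^ 2 * (m.choose k : ℚ) ^ 3 = G (k + 1) - G k := by
    intro k
    have h1 : ((m : ℚ) + 1) ≠ 0 := by positivity
    have h2 : ((m : ℚ) + 2) ≠ 0 := by positivity
    have h3 : ((k : ℚ) + 1) ≠ 0 := by positivity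
    simp only [G]
    rw [cast_choose_eq_div_mul_choose_succ m k, cast_choose_eq_div_mul_choose_succ (m + 1) k,
      cast_choose_succ_right (m + 2) k]
    push_cast
    rw [show (m : ℚ) + 1 + 1 = m + 2 by ring, show m + 1 + 1 = m + 2 by ring]
    field_simp
    ring
  have tel := Finset.sum_range_sub G (m + 3)
  have hG0 : G 0 = 0 := by simp [G]
  have hGN : G (m + 3) = 0 := by simp [G]
  rw [hG0, hGN, Finset.sum_congr rfl (fun k _ => (key k).symm)] at tel
  rw [franel_eq_sum_range (show m ≤ m + 2 by omega),
    franel_eq_sum_range (show m + 1 ≤ m + 2 by omega),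
    franel_eq_sum_range (show m + 2 ≤ m + 2 by omega)]
  simp only [Finset.sum_sub_distrib, ← Finset.mul_sum] at tel
  have : (((m : ℤ) + 2) ^ 2 * ∑ l ∈ Finset.range (m + 2 + 1), ((m + 2).choose l : ℤ) ^ 3 : ℚ)
      = ((7 * (m + 1) ^ 2 + 7 * (m + 1) + 2)
          * ∑ l ∈ Finset.range (m + 2 + 1), ((m + 1).choose l : ℤ) ^ 3
        + 8 * (m + 1) ^ 2 * ∑ l ∈ Finset.range (m + 2 + 1), (m.choose l : ℤ) ^ 3 : ℚ) := by
    push_cast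
    linear_combination tel
  exact_mod_cast this

theorem gNum_recurrence (m : ℕ) :
    ((m : ℤ) + 2) ^ 2 * gNum (m + 2)
      = (10 * (m + 1) ^ 2 + 10 * (m + 1) + 3) * gNum (m + 1) - 9 * (m + 1) ^ 2 * gNum m := by
  let G : ℕ → ℚ := fun k =>
    (3 * (k : ℚ) - 4 - 4 * (m + 1)) * k ^ 2
      * ((m + 2).choose k : ℚ) ^ 2 * (k * ((2 * k).choose k : ℚ)) / (m + 2) ^ 2
  have key : ∀ k : ℕ, ((m : ℚ) + 2) ^ 2 * (((m + 2).choose k : ℚ) ^ 2 * ((2 * k).choose k : ℚ))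
      - (10 * (m + 1) ^ 2 + 10 * (m + 1) + 3)
          * (((m + 1).choose k : ℚ) ^ 2 * ((2 * k).choose k : ℚ))
      + 9 * (m + 1) ^ 2 * ((m.choose k : ℚ) ^ 2 * ((2 * k).choose k : ℚ)) = G (k + 1) - G k := by
    intro k
    have h1 : ((m : ℚ) + 1) ≠ 0 := by positivity
    have h2 : ((m : ℚ) + 2) ≠ 0 := by positivity
    have h3 : ((k : ℚ) + 1) ≠ 0 := by positivity
    simp only [G]
    push_cast
    rw [cast_centralBinom_succ, cast_choose_eq_div_mul_choose_succ m k,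
      cast_choose_eq_div_mul_choose_succ (m + 1) k, cast_choose_succ_right (m + 2) k]
    push_cast
    rw [show (m : ℚ) + 1 + 1 = m + 2 by ring, show m + 1 + 1 = m + 2 by ring]
    field_simp
    ring
  have tel := Finset.sum_range_sub G (m + 3)
  have hG0 : G 0 = 0 := by simp [G]
  have hGN : G (m + 3) = 0 := by simp [G]
  rw [hG0, hGN, Finset.sum_congr rfl (fun k _ => (key k).symm)] at tel
  rw [gNum_eq_sum_range (show m ≤ m + 2 by omega),
    gNum_eq_sum_range (show m + 1 ≤ m + 2 by omega),
    gNum_eq_sum_range (show m + 2 ≤ m + 2 by omega)]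
  simp only [Finset.sum_sub_distrib, Finset.sum_add_distrib, ← Finset.mul_sum] at tel
  have : (((m : ℤ) + 2) ^ 2
          * ∑ l ∈ Finset.range (m + 2 + 1), ((m + 2).choose l : ℤ) ^ 2 * ((2 * l).choose l : ℤ) : ℚ)
      = ((10 * (m + 1) ^ 2 + 10 * (m + 1) + 3)
          * ∑ l ∈ Finset.range (m + 2 + 1), ((m + 1).choose l : ℤ) ^ 2 * ((2 * l).choose l : ℤ)
        - 9 * (m + 1) ^ 2
          * ∑ l ∈ Finset.range (m + 2 + 1), (m.choose l : ℤ) ^ 2 * ((2 * l).choose l : ℤ) : ℚ) := by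
    push_cast
    linear_combination tel
  exact_mod_cast this

theorem apery_recurrence (m : ℕ) :
    ((m : ℤ) + 2) ^ 3 * apery (m + 2)
      = (2 * (m + 1) + 1) * (17 * (m + 1) ^ 2 + 17 * (m + 1) + 5) * apery (m + 1)
        - (m + 1) ^ 3 * apery m := by
  let G : ℕ → ℚ := fun k =>
    4 * (2 * (m + 1) + 1) * ((k - 1) * (2 * k - 1) - (2 * (m + 1) + 1) ^ 2)
      * (k ^ 2 / ((m + 1) * (m + 2)) * ((m + 2).choose k : ℚ) * ((m + k).choose k : ℚ)) ^ 2
  have key : ∀ k : ℕ,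
      ((m : ℚ) + 2) ^ 3 * (((m + 2).choose k : ℚ) ^ 2 * ((m + 2 + k).choose k : ℚ) ^ 2)
      - (2 * (m + 1) + 1) * (17 * (m + 1) ^ 2 + 17 * (m + 1) + 5)
          * (((m + 1).choose k : ℚ) ^ 2 * ((m + 1 + k).choose k : ℚ) ^ 2)
      + (m + 1) ^ 3 * ((m.choose k : ℚ) ^ 2 * ((m + k).choose k : ℚ) ^ 2) = G (k + 1) - G k := by
    intro k
    have h1 : ((m : ℚ) + 1) ≠ 0 := by positivity
    have h2 : ((m : ℚ) + 2) ≠ 0 := by positivity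
    have h3 : ((k : ℚ) + 1) ≠ 0 := by positivity
    simp only [G]
    rw [show m + 2 + k = m + 1 + 1 + k by ring, cast_choose_succ_add (m + 1) k,
      cast_choose_succ_add m k, cast_choose_add_succ m k, cast_choose_eq_div_mul_choose_succ m k,
      cast_choose_eq_div_mul_choose_succ (m + 1) k, cast_choose_succ_right (m + 2) k]
    push_cast
    rw [show (m : ℚ) + 1 + 1 = m + 2 by ring, show m + 1 + 1 = m + 2 by ring]
    field_simp
    ring
  have tel := Finset.sum_range_sub G (m + 3)
  have hG0 : G 0 = 0 := by simp [G]
  have hGN : G (m + 3) = 0 := by simp [G]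
  rw [hG0, hGN, Finset.sum_congr rfl (fun k _ => (key k).symm)] at tel
  rw [apery_eq_sum_range (show m ≤ m + 2 by omega),
    apery_eq_sum_range (show m + 1 ≤ m + 2 by omega),
    apery_eq_sum_range (show m + 2 ≤ m + 2 by omega)]
  simp only [Finset.sum_sub_distrib, Finset.sum_add_distrib, ← Finset.mul_sum] at tel
  have : (((m : ℤ) + 2) ^ 3 * ∑ l ∈ Finset.range (m + 2 + 1),
          ((m + 2).choose l : ℤ) ^ 2 * ((m + 2 + l).choose l : ℤ) ^ 2 : ℚ)
      = ((2 * (m + 1) + 1) * (17 * (m + 1) ^ 2 + 17 * (m + 1) + 5)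
          * ∑ l ∈ Finset.range (m + 2 + 1),
              ((m + 1).choose l : ℤ) ^ 2 * ((m + 1 + l).choose l : ℤ) ^ 2
        - (m + 1) ^ 3 * ∑ l ∈ Finset.range (m + 2 + 1),
              (m.choose l : ℤ) ^ 2 * ((m + l).choose l : ℤ) ^ 2 : ℚ) := by
    push_cast
    linear_combination tel
  exact_mod_cast this

/-! ### Closed forms of the weighted sums -/

theorem three_mul_sum_franel (m : ℕ) :
    3 * ∑ k ∈ Finset.range (m + 1),
        (12 * (k : ℤ) ^ 4 + 25 * (k : ℤ) ^ 3 + 21 * (k : ℤ) ^ 2 + 6 * (k : ℤ))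
          * (-1) ^ k * franel k
      = (-1) ^ m * ((m : ℤ) + 1) ^ 3 * m
          * (8 * (m + 2) * franel m - (m - 1) * franel (m + 1)) := by
  induction m with
  | zero => simp
  | succ m ih =>
    rw [Finset.sum_range_succ, mul_add, ih, pow_succ]
    push_cast
    linear_combination (-1 : ℤ) ^ m * (-(m * (m + 1) * (m + 2)) : ℤ) * franel_recurrence m

theorem two_mul_sum_gNum (m : ℕ) :
    2 * ∑ k ∈ Finset.range (m + 1),
        (12 * (k : ℤ) ^ 3 + 34 * (k : ℤ) ^ 2 + 30 * (k : ℤ) + 9) * gNum k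
      = ((m : ℤ) + 1) ^ 3 * (9 * (m + 2) * gNum m - m * gNum (m + 1)) := by
  induction m with
  | zero => simp [gNum]
  | succ m ih =>
    rw [Finset.sum_range_succ, mul_add, ih]
    push_cast
    linear_combination ((m + 1) * (m + 2) : ℤ) * gNum_recurrence m

theorem two_mul_sum_apery (m : ℕ) :
    2 * ∑ k ∈ Finset.range (m + 1),
        (18 * (k : ℤ) ^ 5 + 45 * (k : ℤ) ^ 4 + 46 * (k : ℤ) ^ 3 + 24 * (k : ℤ) ^ 2
            + 7 * (k : ℤ) + 1) * (-1) ^ k * apery k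
      = (-1) ^ m * ((m : ℤ) + 1) ^ 4 * ((m + 2) * apery m + m * apery (m + 1)) := by
  induction m with
  | zero => simp [apery]
  | succ m ih =>
    rw [Finset.sum_range_succ, mul_add, ih, pow_succ]
    push_cast
    linear_combination (-1 : ℤ) ^ m * ((m + 1) * (m + 2) : ℤ) * apery_recurrence m

/-! ### Congruences to the moduli 2, 3 and 4 -/

theorem franel_cast_eq_two_pow {R : Type*} [CommRing R] (hR : ∀ x : R, x ^ 3 = x) (n : ℕ) :
    (franel n : R) = 2 ^ n := by
  have h : (∑ l ∈ Finset.range (n + 1), (n.choose l : R)) = 2 ^ n := by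
    exact_mod_cast congrArg (Nat.cast : ℕ → R) (Nat.sum_range_choose n)
  rw [franel, ← h]
  push_cast
  exact Finset.sum_congr rfl fun l _ => hR _

theorem two_dvd_franel {n : ℕ} (hn : n ≠ 0) : (2 : ℤ) ∣ franel n := by
  have h := franel_cast_eq_two_pow (R := ZMod 2) (by decide) n
  rw [show (2 : ZMod 2) = 0 from rfl, zero_pow hn] at h
  exact_mod_cast (ZMod.intCast_zmod_eq_zero_iff_dvd (franel n) 2).mp h

theorem four_dvd_franel {n : ℕ} (h1 : 1 < n) (hn : Odd n) : (4 : ℤ) ∣ franel n := by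
  obtain ⟨r, rfl⟩ := hn
  obtain ⟨s, rfl⟩ : ∃ s, r = s + 1 := ⟨r - 1, by omega⟩
  have hrec := franel_recurrence (2 * s + 1)
  obtain ⟨a, ha⟩ := two_dvd_franel (n := 2 * s + 1 + 1) (by omega)
  rw [ha] at hrec
  rw [show 2 * (s + 1) + 1 = 2 * s + 1 + 2 by ring]
  push_cast at hrec
  have hodd : (((2 * s + 1 : ℤ) + 2) ^ 2) = 4 * ((s + 1) * (s + 2)) + 1 := by ring
  refine ⟨a * (14 * (s + 1) ^ 2 + 7 * (s + 1) + 1) + 8 * (s + 1) ^ 2 * franel (2 * s + 1)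
    - (s + 1) * (s + 2) * franel (2 * s + 1 + 2), ?_⟩
  rw [hodd] at hrec
  linear_combination hrec

theorem twelve_dvd_franel_combination {m : ℕ} (hm : 0 < m) :
    (12 : ℤ) ∣ ((m : ℤ) + 1) * (8 * (m + 2) * franel m - (m - 1) * franel (m + 1)) := by
  have h3 : (3 : ℤ) ∣ ((m : ℤ) + 1) * (8 * (m + 2) * franel m - (m - 1) * franel (m + 1)) := by
    have := (ZMod.intCast_zmod_eq_zero_iff_dvd
      (((m : ℤ) + 1) * (8 * (m + 2) * franel m - (m - 1) * franel (m + 1))) 3).mp (by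
        push_cast
        rw [franel_cast_eq_two_pow (by decide), franel_cast_eq_two_pow (by decide), pow_succ]
        have h : (3 : ZMod 3) = 0 := rfl
        linear_combination ((m : ZMod 3) + 1) * 2 ^ m * (2 * m + 6) * h)
    exact_mod_cast this
  have h4 : (4 : ℤ) ∣ ((m : ℤ) + 1) * (8 * (m + 2) * franel m - (m - 1) * franel (m + 1)) := by
    rcases Nat.even_or_odd m with h | h
    · obtain ⟨a, ha⟩ := four_dvd_franel (n := m + 1) (by omega) h.add_one
      rw [ha]
      exact ⟨((m : ℤ) + 1) * (2 * (m + 2) * franel m - (m - 1) * a), by ring⟩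
    · obtain ⟨r, rfl⟩ := h
      refine ⟨(r + 1) * (4 * (2 * r + 3) * franel (2 * r + 1) - r * franel (2 * r + 1 + 1)), ?_⟩
      push_cast
      ring
  omega

theorem odd_gNum (n : ℕ) : Odd (gNum n) := by
  rw [gNum, Finset.sum_range_succ']
  refine Even.add_odd (Finset.even_sum _ fun l _ => ?_) (by simp)
  have h := Nat.two_dvd_centralBinom_of_one_le (n := l + 1) (by omega)
  rw [Nat.centralBinom] at h
  exact Even.mul_left ((Int.even_coe_nat _).mpr (even_iff_two_dvd.mpr h)) _

theorem odd_apery (n : ℕ) : Odd (apery n) := by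
  rw [apery, Finset.sum_range_succ']
  refine Even.add_odd (Finset.even_sum _ fun l hl => ?_) (by simp)
  have hl' : l < n := by simpa using hl
  have h := Nat.two_dvd_centralBinom_of_one_le (n := l + 1) (by omega)
  rw [Nat.centralBinom] at h
  have e := Nat.choose_mul (n := n + (l + 1)) (k := 2 * (l + 1)) (s := l + 1)
    (by omega)
  rw [show n + (l + 1) - (l + 1) = n by omega,
    show 2 * (l + 1) - (l + 1) = l + 1 by omega] at e
  have h2 : Even (n.choose (l + 1) * (n + (l + 1)).choose (l + 1)) := by
    rw [mul_comm, ← e]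
    exact Even.mul_left (even_iff_two_dvd.mpr h) _
  rw [← mul_pow]
  exact Even.pow_of_ne_zero (by exact_mod_cast h2) two_ne_zero

theorem sum_range_three_mul_add_one {M : Type*} [AddCommMonoid M] (t : ℕ → M)
    (ht : ∀ l, ¬ 3 ∣ l → t l = 0) (J : ℕ) :
    ∑ l ∈ Finset.range (3 * J + 1), t l = ∑ l ∈ Finset.range (J + 1), t (3 * l) := by
  induction J with
  | zero => simp
  | succ J ih =>
    rw [Finset.sum_range_succ _ (J + 1), ← ih, show 3 * (J + 1) + 1 = 3 * J + 1 + 1 + 1 + 1 by ring,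
      Finset.sum_range_succ, Finset.sum_range_succ, Finset.sum_range_succ,
      ht (3 * J + 1) (by omega), ht (3 * J + 1 + 1) (by omega)]
    simp [mul_add]

theorem choose_three_mul_cast (a l : ℕ) :
    ((3 * a).choose l : ZMod 3) = (0 : ℕ).choose (l % 3) * a.choose (l / 3) := by
  have h := Choose.choose_modEq_choose_mod_mul_choose_div_nat (n := 3 * a) (k := l) (p := 3)
  rw [Nat.mul_mod_right, Nat.mul_div_cancel_left _ (by norm_num : 0 < 3)] at h
  exact_mod_cast (ZMod.natCast_eq_natCast_iff _ _ _).mpr h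

theorem gNum_three_mul_cast (J : ℕ) : (gNum (3 * J) : ZMod 3) = (gNum J : ZMod 3) := by
  rw [gNum, gNum]
  push_cast
  rw [sum_range_three_mul_add_one]
  · refine Finset.sum_congr rfl fun l _ => ?_
    rw [show 2 * (3 * l) = 3 * (2 * l) by ring, choose_three_mul_cast, choose_three_mul_cast]
    simp
  · intro l hl
    rw [choose_three_mul_cast, Nat.choose_eq_zero_of_lt (show 0 < l % 3 by omega)]
    simp

theorem three_dvd_gNum {n : ℕ} (hn : n ≠ 0) : (3 : ℤ) ∣ gNum n := by
  have key : ∀ n : ℕ, n ≠ 0 → (gNum n : ZMod 3) = 0 := by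
    intro n
    induction n using Nat.strong_induction_on with
    | _ n ih =>
    intro hn
    have h3 : (3 : ZMod 3) = 0 := rfl
    obtain ⟨j, hj | hj | hj⟩ : ∃ j, n = 3 * j ∨ n = 3 * j + 1 ∨ n = 3 * j + 2 :=
      ⟨n / 3, by omega⟩
    · rw [hj, gNum_three_mul_cast]
      exact ih j (by omega) (by omega)
    · rcases Nat.eq_zero_or_pos j with h0 | h0
      · subst h0
        subst hj
        decide
      · obtain ⟨i, rfl⟩ : ∃ i, j = i + 1 := ⟨j - 1, by omega⟩
        have hrec := congrArg (Int.cast : ℤ → ZMod 3) (gNum_recurrence (3 * i + 2))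
        rw [hj, show 3 * (i + 1) + 1 = 3 * i + 2 + 2 by ring]
        push_cast at hrec
        linear_combination hrec + h3 * (-(3 * i ^ 2 + 8 * i + 5) * (gNum (3 * i + 2 + 2) : ZMod 3)
          + (10 * (i + 1) * (3 * i + 4) + 1) * (gNum (3 * i + 2 + 1) : ZMod 3)
          - 27 * (i + 1) ^ 2 * (gNum (3 * i + 2) : ZMod 3))
    · have hrec := congrArg (Int.cast : ℤ → ZMod 3) (gNum_recurrence (3 * j))
      have h1 := ih (3 * j + 1) (by omega) (by omega)
      rw [hj]
      push_cast at hrec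
      rw [h1] at hrec
      linear_combination hrec + h3 * (-(3 * j ^ 2 + 4 * j + 1) * (gNum (3 * j + 2) : ZMod 3)
        - 3 * (3 * j + 1) ^ 2 * (gNum (3 * j) : ZMod 3))
  exact_mod_cast (ZMod.intCast_zmod_eq_zero_iff_dvd (gNum n) 3).mp (key n hn)

/-! ### Binomial coefficients modulo a prime -/

theorem natCast_mul_choose_eq {p l : ℕ} (hl : l ∈ Finset.Ico 1 p) :
    (l : ℤ) * (p.choose l : ℤ) = p * ((p - 1).choose (l - 1) : ℤ) := by
  have hl' := Finset.mem_Ico.mp hl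
  obtain ⟨q, hq⟩ : ∃ q, p = q + 1 := ⟨p - 1, by omega⟩
  obtain ⟨j, rfl⟩ : ∃ j, l = j + 1 := ⟨l - 1, by omega⟩
  have := Nat.add_one_mul_choose_eq q j
  simp only [hq, Nat.add_sub_cancel]
  rw [mul_comm ((j + 1 : ℕ) : ℤ)]
  exact_mod_cast this.symm

section Prime

variable {p : ℕ} [hp : Fact p.Prime]

theorem choose_prime_cast {l : ℕ} (h0 : l ≠ 0) (hl : l < p) : (p.choose l : ZMod p) = 0 :=
  (ZMod.natCast_eq_zero_iff _ _).mpr (hp.out.dvd_choose_self h0 hl)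

theorem choose_prime_sub_one_cast {l : ℕ} (hl : l < p) :
    ((p - 1).choose l : ZMod p) = (-1) ^ l := by
  induction l with
  | zero => simp
  | succ l ih =>
    have h := choose_prime_cast (p := p) (l := l + 1) (by omega) hl
    obtain ⟨q, rfl⟩ : ∃ q, p = q + 1 := ⟨p - 1, by omega⟩
    rw [Nat.choose_succ_succ] at h
    have ih := ih (by omega)
    simp only [Nat.add_sub_cancel] at ih ⊢
    push_cast at h
    rw [ih] at h
    rw [pow_succ]
    linear_combination h

theorem choose_prime_add_cast {l : ℕ} (hl : l < p) : ((p + l).choose l : ZMod p) = 1 := by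
  have h := Choose.choose_modEq_choose_mod_mul_choose_div_nat (n := p + l) (k := l) (p := p)
  rw [Nat.add_mod_left, Nat.mod_eq_of_lt hl, Nat.div_eq_of_lt hl] at h
  have := (ZMod.natCast_eq_natCast_iff _ _ _).mpr h
  simpa using this

theorem sum_range_prime_cast {M : Type*} [AddCommMonoid M] (h : ZMod p → M) :
    ∑ l ∈ Finset.range p, h (l : ZMod p) = ∑ x : ZMod p, h x := by
  refine Finset.sum_bij (fun l _ => (l : ZMod p)) (fun _ _ => Finset.mem_univ _) ?_ ?_
    (fun _ _ => rfl)
  · intro a ha b hb hab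
    have := (ZMod.natCast_eq_natCast_iff' _ _ _).mp hab
    rwa [Nat.mod_eq_of_lt (Finset.mem_range.mp ha), Nat.mod_eq_of_lt (Finset.mem_range.mp hb)]
      at this
  · intro x _
    exact ⟨x.val, Finset.mem_range.mpr (ZMod.val_lt x), ZMod.natCast_zmod_val x⟩

theorem sum_inv_sq_eq_zero (h3 : 3 < p) :
    ∑ l ∈ Finset.Ico 1 p, ((l : ZMod p)⁻¹) ^ 2 = 0 := by
  have h1 : ∑ l ∈ Finset.range p, ((l : ZMod p)⁻¹) ^ 2 = 0 := by
    rw [sum_range_prime_cast (fun x : ZMod p => x⁻¹ ^ 2),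
      (inv_involutive (G := ZMod p)).bijective.sum_comp (fun x => x ^ 2)]
    exact FiniteField.sum_pow_lt_card_sub_one _ _ (by rw [ZMod.card]; omega)
  rw [Finset.range_eq_Ico, Finset.sum_eq_sum_Ico_succ_bot (by omega)] at h1
  simpa using h1

/-- If `a l` is `p / l` times an integer congruent to `± 1` modulo `p`, the squares of the `a l`
sum to `0` modulo `p ^ 3`. -/
theorem cube_dvd_sum_sq (h3 : 3 < p) (a e : ℕ → ℤ)
    (hae : ∀ l ∈ Finset.Ico 1 p, (l : ℤ) * a l = p * e l)
    (he : ∀ l ∈ Finset.Ico 1 p, (e l : ZMod p) ^ 2 = 1) :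
    (p : ℤ) ^ 3 ∣ ∑ l ∈ Finset.Ico 1 p, a l ^ 2 := by
  have hpz : (p : ℤ) ≠ 0 := by exact_mod_cast hp.out.ne_zero
  have hdvd : ∀ l ∈ Finset.Ico 1 p, ∃ c : ℤ, a l = p * c := by
    intro l hl
    have hl' := Finset.mem_Ico.mp hl
    have hpr : Prime (p : ℤ) := Nat.prime_iff_prime_int.mp hp.out
    rcases hpr.dvd_or_dvd (Dvd.intro _ (hae l hl).symm) with h | h
    · have := Nat.le_of_dvd (by omega) (Int.natCast_dvd_natCast.mp h)
      omega
    · exact h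
  choose! c hc using hdvd
  rw [Finset.sum_congr rfl fun l hl => by rw [hc l hl, mul_pow], ← Finset.mul_sum, pow_succ]
  refine mul_dvd_mul_left _ ?_
  rw [← ZMod.intCast_zmod_eq_zero_iff_dvd, ← sum_inv_sq_eq_zero h3]
  push_cast
  refine Finset.sum_congr rfl fun l hl => ?_
  have hl' := Finset.mem_Ico.mp hl
  have hl0 : (l : ZMod p) ≠ 0 := by
    rw [Ne, ZMod.natCast_eq_zero_iff]
    intro h
    have := Nat.le_of_dvd (by omega) h
    omega
  have h1 : (l : ℤ) * c l = e l := by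
    have := hae l hl
    rw [hc l hl] at this
    exact mul_left_cancel₀ hpz (by linear_combination this)
  have h2 : (l : ZMod p) * (c l : ZMod p) = (e l : ZMod p) := by exact_mod_cast congrArg _ h1
  have h4 := he l hl
  rw [← h2] at h4
  field_simp
  linear_combination h4

theorem choose_prime_sub_one_cast_sq {l : ℕ} (hl : l < p) :
    ((p - 1).choose l : ZMod p) ^ 2 = 1 := by
  rw [choose_prime_sub_one_cast hl, ← pow_mul, mul_comm, pow_mul]
  simp

theorem centralBinom_prime_modEq (h3 : 3 < p) : ((2 * p).choose p : ℤ) ≡ 2 [ZMOD p ^ 3] := by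
  have h := cube_dvd_sum_sq h3 (fun l => (p.choose l : ℤ)) (fun l => ((p - 1).choose (l - 1) : ℤ))
    (fun l hl => natCast_mul_choose_eq hl) (fun l hl => by
      have := Finset.mem_Ico.mp hl
      push_cast
      exact choose_prime_sub_one_cast_sq (by omega))
  have e : ((2 * p).choose p : ℤ) = 2 + ∑ l ∈ Finset.Ico 1 p, (p.choose l : ℤ) ^ 2 := by
    rw [← Nat.sum_range_choose_sq, Finset.sum_range_succ, Finset.range_eq_Ico,
      Finset.sum_eq_sum_Ico_succ_bot (by omega)]
    push_cast
    simp
    ring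
  rw [e, Int.modEq_comm, Int.modEq_iff_dvd]
  simpa using h

theorem apery_prime_modEq (h3 : 3 < p) : apery p ≡ 5 [ZMOD p ^ 3] := by
  have h := cube_dvd_sum_sq h3 (fun l => (p.choose l : ℤ) * ((p + l).choose l : ℤ))
    (fun l => ((p - 1).choose (l - 1) : ℤ) * ((p + l).choose l : ℤ))
    (fun l hl => by rw [← mul_assoc, natCast_mul_choose_eq hl, mul_assoc]) (fun l hl => by
      have := Finset.mem_Ico.mp hl
      push_cast
      rw [choose_prime_add_cast (by omega), mul_one]
      exact choose_prime_sub_one_cast_sq (by omega))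
  have e : apery p = (∑ l ∈ Finset.Ico 1 p, ((p.choose l : ℤ) * ((p + l).choose l : ℤ)) ^ 2)
      + (1 + ((2 * p).choose p : ℤ) ^ 2) := by
    rw [apery, Finset.sum_range_succ, Finset.range_eq_Ico,
      Finset.sum_eq_sum_Ico_succ_bot (by omega)]
    simp [mul_pow, two_mul]
    ring
  rw [e]
  exact (((Int.modEq_zero_iff_dvd.mpr h).add_right _).trans
    (((centralBinom_prime_modEq h3).pow 2).add_left 1 |>.add_left 0))

theorem apery_prime_sub_one_modEq (h3 : 3 < p) : apery (p - 1) ≡ 1 [ZMOD p ^ 3] := by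
  have h := cube_dvd_sum_sq h3 (fun l => ((p - 1).choose l : ℤ) * ((p - 1 + l).choose l : ℤ))
    (fun l => ((p - 1).choose l : ℤ) * ((p + (l - 1)).choose (l - 1) : ℤ))
    (fun l hl => by
      have := Finset.mem_Ico.mp hl
      obtain ⟨q, hq⟩ : ∃ q, p = q + 1 := ⟨p - 1, by omega⟩
      obtain ⟨j, rfl⟩ : ∃ j, l = j + 1 := ⟨l - 1, by omega⟩
      have e := Nat.choose_succ_right_eq (q + 1 + j) j
      rw [Nat.add_sub_cancel] at e
      simp only [hq, Nat.add_sub_cancel]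
      rw [show q + (j + 1) = q + 1 + j by ring]
      have e' : ((q + 1 + j).choose (j + 1) : ℤ) * ((j + 1 : ℕ) : ℤ)
          = (q + 1 + j).choose j * ((q + 1 : ℕ) : ℤ) := by exact_mod_cast e
      linear_combination (q.choose (j + 1) : ℤ) * e') (fun l hl => by
      have := Finset.mem_Ico.mp hl
      push_cast
      rw [choose_prime_add_cast (by omega), mul_one]
      exact choose_prime_sub_one_cast_sq (by omega))
  have e : apery (p - 1) = (∑ l ∈ Finset.Ico 1 p,
      (((p - 1).choose l : ℤ) * ((p - 1 + l).choose l : ℤ)) ^ 2) + 1 := by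
    rw [apery, Nat.sub_add_cancel (by omega), Finset.range_eq_Ico,
      Finset.sum_eq_sum_Ico_succ_bot (by omega)]
    simp [mul_pow]
    ring
  rw [e]
  exact (Int.modEq_zero_iff_dvd.mpr h).add_right 1

theorem franel_prime_cast : (franel p : ZMod p) = 2 := by
  have hp0 := hp.out.pos
  rw [franel]
  push_cast
  rw [Finset.sum_range_succ, Finset.range_eq_Ico, Finset.sum_eq_sum_Ico_succ_bot hp0,
    Finset.sum_eq_zero fun l hl => ?_]
  · simp
    norm_num
  · have := Finset.mem_Ico.mp hl
    rw [choose_prime_cast (by omega) (by omega)]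
    simp

theorem franel_prime_sub_one_cast (h : Odd p) : (franel (p - 1) : ZMod p) = 1 := by
  rw [franel, Nat.sub_add_cancel hp.out.one_le]
  push_cast
  have : ∀ l ∈ Finset.range p, ((p - 1).choose l : ZMod p) ^ 3 = (-1) ^ l := by
    intro l hl
    rw [choose_prime_sub_one_cast (Finset.mem_range.mp hl), ← pow_mul, mul_comm, pow_mul]
    norm_num
  rw [Finset.sum_congr rfl this, neg_one_geom_sum, if_neg (Nat.not_even_iff_odd.mpr h)]

theorem gNum_prime_cast : (gNum p : ZMod p) = 3 := by
  have hp0 := hp.out.pos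
  have hc : ((2 * p).choose p : ZMod p) = 2 := by
    have h := Choose.choose_modEq_choose_mod_mul_choose_div_nat (n := 2 * p) (k := p) (p := p)
    rw [Nat.mul_mod_left, Nat.mod_self, Nat.mul_div_cancel _ hp0, Nat.div_self hp0] at h
    simpa using (ZMod.natCast_eq_natCast_iff _ _ _).mpr h
  rw [gNum]
  push_cast
  rw [Finset.sum_range_succ, Finset.range_eq_Ico, Finset.sum_eq_sum_Ico_succ_bot hp0,
    Finset.sum_eq_zero fun l hl => ?_]
  · rw [hc]
    simp
    norm_num
  · have := Finset.mem_Ico.mp hl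
    rw [choose_prime_cast (by omega) (by omega)]
    simp

theorem centralBinom_cast_eq (h : Odd p) {l : ℕ} (hl : l < p) :
    ((2 * l).choose l : ZMod p) = (-4) ^ l * ((p / 2).choose l : ZMod p) := by
  induction l with
  | zero => simp
  | succ l ih =>
    have ih := ih (by omega)
    have hl0 : ((l : ZMod p) + 1) ≠ 0 := by
      rw [← Nat.cast_succ, Ne, ZMod.natCast_eq_zero_iff]
      intro h
      have := Nat.le_of_dvd (by omega) h
      omega
    have e1 : ((l : ZMod p) + 1) * ((2 * (l + 1)).choose (l + 1) : ZMod p)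
        = 2 * (2 * l + 1) * ((2 * l).choose l : ZMod p) := by
      have := Nat.succ_mul_centralBinom_succ l
      simp only [Nat.centralBinom] at this
      exact_mod_cast congrArg (Nat.cast : ℕ → ZMod p) this
    have hp2 : (2 : ZMod p) * ((p / 2 : ℕ) : ZMod p) + 1 = 0 := by
      have : 2 * (p / 2) + 1 = p := Nat.two_mul_div_two_add_one_of_odd h
      have := congrArg (Nat.cast : ℕ → ZMod p) this
      push_cast at this
      rw [this, ZMod.natCast_self]
    have e2 : ((p / 2).choose (l + 1) : ZMod p) * (l + 1)
        = ((p / 2).choose l : ZMod p) * (((p / 2 : ℕ) : ZMod p) - l) := by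
      rcases le_or_gt l (p / 2) with hle | hgt
      · have := congrArg (Nat.cast : ℕ → ZMod p) (Nat.choose_succ_right_eq (p / 2) l)
        rw [Nat.cast_mul, Nat.cast_mul, Nat.cast_sub hle] at this
        exact_mod_cast this
      · rw [Nat.choose_eq_zero_of_lt hgt, Nat.choose_eq_zero_of_lt (by omega)]
        simp
    apply mul_left_cancel₀ hl0
    rw [e1, ih, pow_succ]
    linear_combination 4 * (-4) ^ l * e2
      + 2 * (-4) ^ l * ((p / 2).choose l : ZMod p) * hp2

theorem sum_centralBinom_cast (h : Odd p) :
    ∑ l ∈ Finset.range p, ((2 * l).choose l : ZMod p) = (legendreSym 3 (p : ℤ) : ZMod p) := by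
  have hp2 : p ≠ 2 := by
    rintro rfl
    exact absurd h (by decide)
  have h1 : ∑ l ∈ Finset.range p, ((2 * l).choose l : ZMod p)
      = ∑ l ∈ Finset.range (p / 2 + 1), (-4) ^ l * ((p / 2).choose l : ZMod p) := by
    rw [Finset.sum_congr rfl fun l hl => centralBinom_cast_eq h (Finset.mem_range.mp hl)]
    symm
    apply Finset.sum_subset
    · have := hp.out.two_le
      exact Finset.range_mono (by omega)
    · intro l _ hl
      rw [Nat.choose_eq_zero_of_lt (by simpa using hl)]
      simp
  have h2 := add_pow (-4 : ZMod p) 1 (p / 2)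
  simp only [one_pow, mul_one] at h2
  rw [h1, ← h2, legendreSym.quadratic_reciprocity' hp2 (by norm_num : (3 : ℕ) ≠ 2)]
  push_cast
  rw [legendreSym.eq_pow, mul_one]
  push_cast
  rw [← mul_pow]
  norm_num

theorem gNum_prime_sub_one_cast (h : Odd p) :
    (gNum (p - 1) : ZMod p) = (legendreSym 3 (p : ℤ) : ZMod p) := by
  rw [← sum_centralBinom_cast h, gNum, Nat.sub_add_cancel hp.out.one_le]
  push_cast
  refine Finset.sum_congr rfl fun l hl => ?_
  rw [choose_prime_sub_one_cast_sq (Finset.mem_range.mp hl), one_mul]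

end Prime

/-! ### Congruences for the weighted sums -/

theorem sum_franel_modEq_zero {n : ℕ} (hn : 1 < n) :
    ∑ k ∈ Finset.range n,
        (12 * (k : ℤ) ^ 4 + 25 * (k : ℤ) ^ 3 + 21 * (k : ℤ) ^ 2 + 6 * (k : ℤ))
          * (-1) ^ k * franel k
      ≡ 0 [ZMOD 4 * (n : ℤ) ^ 2 * ((n : ℤ) - 1)] := by
  obtain ⟨m, rfl⟩ : ∃ m, n = m + 1 := ⟨n - 1, by omega⟩
  obtain ⟨e, he⟩ := twelve_dvd_franel_combination (m := m) (by omega)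
  have h := three_mul_sum_franel m
  refine Int.modEq_zero_iff_dvd.mpr ⟨(-1) ^ m * e, ?_⟩
  apply mul_left_cancel₀ (three_ne_zero (α := ℤ))
  rw [h]
  push_cast
  linear_combination (-1) ^ m * ((m : ℤ) + 1) ^ 2 * m * he

theorem sum_franel_prime_modEq {p : ℕ} (hp : p.Prime) (hodd : Odd p) :
    ∑ k ∈ Finset.range p,
        (12 * (k : ℤ) ^ 4 + 25 * (k : ℤ) ^ 3 + 21 * (k : ℤ) ^ 2 + 6 * (k : ℤ))
          * (-1) ^ k * franel k
      ≡ -4 * (p : ℤ) ^ 3 [ZMOD (p : ℤ) ^ 4] := by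
  rcases eq_or_ne p 3 with rfl | h3
  · decide
  have : Fact p.Prime := ⟨hp⟩
  have h1 := franel_prime_cast (p := p)
  have h2 := franel_prime_sub_one_cast hodd
  have hp0 := hp.pos
  obtain ⟨m, rfl⟩ : ∃ m, p = m + 1 := ⟨p - 1, by omega⟩
  simp only [Nat.add_sub_cancel] at h2
  have hm : Even m := by
    rcases Nat.even_or_odd m with h | h
    · exact h
    · exact absurd h.add_one (Nat.not_even_iff_odd.mpr hodd)
  have h := three_mul_sum_franel m
  rw [hm.neg_one_pow] at h
  have hx : ((m + 1 : ℕ) : ℤ)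
      ∣ (m : ℤ) * (8 * (m + 2) * franel m - (m - 1) * franel (m + 1)) + 12 := by
    rw [← ZMod.intCast_zmod_eq_zero_iff_dvd]
    have hm1 : (m : ZMod (m + 1)) + 1 = 0 := by exact_mod_cast ZMod.natCast_self (m + 1)
    push_cast
    rw [h1, h2]
    linear_combination (6 * (m : ZMod (m + 1)) + 12) * hm1
  obtain ⟨y, hy⟩ := hx
  have hdvd : ((m + 1 : ℕ) : ℤ) ^ 4 ∣ 3 * (-4 * ((m + 1 : ℕ) : ℤ) ^ 3 - ∑ k ∈ Finset.range (m + 1),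
        (12 * (k : ℤ) ^ 4 + 25 * (k : ℤ) ^ 3 + 21 * (k : ℤ) ^ 2 + 6 * (k : ℤ))
          * (-1) ^ k * franel k) := by
    refine ⟨-y, ?_⟩
    rw [mul_sub, h]
    push_cast at hy ⊢
    linear_combination -((m : ℤ) + 1) ^ 3 * hy
  refine Int.modEq_iff_dvd.mpr (IsCoprime.dvd_of_dvd_mul_left ?_ hdvd)
  refine IsCoprime.pow_left (Nat.isCoprime_iff_coprime.mpr ?_)
  exact (Nat.coprime_primes hp Nat.prime_three).mpr h3

theorem sum_gNum_modEq_zero {n : ℕ} (hn : 0 < n) :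
    ∑ k ∈ Finset.range n,
        (12 * (k : ℤ) ^ 3 + 34 * (k : ℤ) ^ 2 + 30 * (k : ℤ) + 9) * gNum k
      ≡ 0 [ZMOD 3 * (n : ℤ) ^ 3] := by
  obtain ⟨m, rfl⟩ : ∃ m, n = m + 1 := ⟨n - 1, by omega⟩
  have h := two_mul_sum_gNum m
  obtain ⟨a, ha⟩ := three_dvd_gNum (n := m + 1) (by omega)
  obtain ⟨b, hb⟩ := odd_gNum m
  obtain ⟨c, hc⟩ := odd_gNum (m + 1)
  have h2 : (2 : ℤ) ∣ 3 * (m + 2) * gNum m - m * a :=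
    ⟨3 * (m + 2) * b + m + 3 - m * (c - a), by
      linear_combination 3 * ((m : ℤ) + 2) * hb - (m : ℤ) * hc + (m : ℤ) * ha⟩
  obtain ⟨e, he⟩ := h2
  refine Int.modEq_zero_iff_dvd.mpr ⟨e, ?_⟩
  apply mul_left_cancel₀ (two_ne_zero (α := ℤ))
  rw [h, ha]
  push_cast
  linear_combination 3 * ((m : ℤ) + 1) ^ 3 * he

theorem sum_gNum_prime_ratModEq {p : ℕ} (hp : p.Prime) (hodd : Odd p) :
    RatModEq (p ^ 4)
      ((∑ k ∈ Finset.range p,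
        (12 * (k : ℤ) ^ 3 + 34 * (k : ℤ) ^ 2 + 30 * (k : ℤ) + 9) * gNum k : ℤ) : ℚ)
      (3 * (p : ℚ) ^ 3 / 2 * (1 + 3 * (legendreSym 3 (p : ℤ) : ℚ))) := by
  have : Fact p.Prime := ⟨hp⟩
  have h1 := gNum_prime_cast (p := p)
  have h2 := gNum_prime_sub_one_cast hodd
  have hp0 := hp.pos
  generalize legendreSym 3 (p : ℤ) = χ at h2 ⊢
  obtain ⟨m, rfl⟩ : ∃ m, p = m + 1 := ⟨p - 1, by omega⟩
  simp only [Nat.add_sub_cancel] at h2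
  have hx : ((m + 1 : ℕ) : ℤ) ∣ 9 * (m + 2) * gNum m - m * gNum (m + 1) - (3 + 9 * χ) := by
    rw [← ZMod.intCast_zmod_eq_zero_iff_dvd]
    have hm1 : (m : ZMod (m + 1)) + 1 = 0 := by exact_mod_cast ZMod.natCast_self (m + 1)
    push_cast
    rw [h1, h2]
    linear_combination (9 * (χ : ZMod (m + 1)) - 3) * hm1
  obtain ⟨y, hy⟩ := hx
  have h := two_mul_sum_gNum m
  refine ⟨(y : ℚ) / 2, ?_, ?_⟩
  · have hden : ((y : ℚ) / 2).den ∣ 2 := by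
      have := Rat.den_dvd y 2
      exact_mod_cast this
    refine Nat.Coprime.coprime_dvd_left hden (Nat.Coprime.pow_right 4 ?_)
    exact Nat.coprime_two_left.mpr hodd
  · have h' := congrArg (Int.cast : ℤ → ℚ) h
    have hy' := congrArg (Int.cast : ℤ → ℚ) hy
    rw [Int.cast_mul] at h'
    set S := ∑ k ∈ Finset.range (m + 1),
      (12 * (k : ℤ) ^ 3 + 34 * (k : ℤ) ^ 2 + 30 * (k : ℤ) + 9) * gNum k
    push_cast at h' hy' ⊢
    linear_combination h' / 2 + ((m : ℚ) + 1) ^ 3 / 2 * hy'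

theorem sum_apery_modEq_zero {n : ℕ} (hn : 0 < n) :
    ∑ k ∈ Finset.range n,
        (18 * (k : ℤ) ^ 5 + 45 * (k : ℤ) ^ 4 + 46 * (k : ℤ) ^ 3 + 24 * (k : ℤ) ^ 2
            + 7 * (k : ℤ) + 1) * (-1) ^ k * apery k
      ≡ 0 [ZMOD (n : ℤ) ^ 4] := by
  obtain ⟨m, rfl⟩ : ∃ m, n = m + 1 := ⟨n - 1, by omega⟩
  have h := two_mul_sum_apery m
  obtain ⟨b, hb⟩ := odd_apery m
  obtain ⟨c, hc⟩ := odd_apery (m + 1)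
  refine Int.modEq_zero_iff_dvd.mpr ⟨(-1) ^ m * ((m + 2) * b + m * c + m + 1), ?_⟩
  apply mul_left_cancel₀ (two_ne_zero (α := ℤ))
  rw [h, hb, hc]
  push_cast
  ring

theorem sum_apery_prime_modEq {p : ℕ} (hp : p.Prime) (h3 : 3 < p) :
    ∑ k ∈ Finset.range p,
        (18 * (k : ℤ) ^ 5 + 45 * (k : ℤ) ^ 4 + 46 * (k : ℤ) ^ 3 + 24 * (k : ℤ) ^ 2
            + 7 * (k : ℤ) + 1) * (-1) ^ k * apery k
      ≡ -2 * (p : ℤ) ^ 4 + 3 * (p : ℤ) ^ 5 [ZMOD (p : ℤ) ^ 7] := by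
  have : Fact p.Prime := ⟨hp⟩
  have h1 := apery_prime_modEq h3
  have h2 := apery_prime_sub_one_modEq h3
  have hodd : Odd p := hp.odd_of_ne_two (by omega)
  obtain ⟨m, rfl⟩ : ∃ m, p = m + 1 := ⟨p - 1, by omega⟩
  simp only [Nat.add_sub_cancel] at h2
  have hm : Even m := by
    rcases Nat.even_or_odd m with h | h
    · exact h
    · exact absurd h.add_one (Nat.not_even_iff_odd.mpr hodd)
  have h := two_mul_sum_apery m
  rw [hm.neg_one_pow] at h
  obtain ⟨a, ha⟩ := h1.dvd
  obtain ⟨b, hb⟩ := h2.dvd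
  set S := ∑ k ∈ Finset.range (m + 1),
        (18 * (k : ℤ) ^ 5 + 45 * (k : ℤ) ^ 4 + 46 * (k : ℤ) ^ 3 + 24 * (k : ℤ) ^ 2
            + 7 * (k : ℤ) + 1) * (-1) ^ k * apery k
  have hdvd : ((m + 1 : ℕ) : ℤ) ^ 7
      ∣ 2 * (-2 * ((m + 1 : ℕ) : ℤ) ^ 4 + 3 * ((m + 1 : ℕ) : ℤ) ^ 5 - S) := by
    refine ⟨(m + 2) * b + m * a, ?_⟩
    rw [mul_sub, h]
    push_cast at ha hb ⊢
    linear_combination ((m : ℤ) + 1) ^ 4 * ((m + 2) * hb + m * ha)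
  refine Int.modEq_iff_dvd.mpr (IsCoprime.dvd_of_dvd_mul_left ?_ hdvd)
  refine IsCoprime.pow_left (Nat.isCoprime_iff_coprime.mpr ?_)
  exact Nat.coprime_two_right.mpr hodd

theorem theorem1p7 :
    -- (i)
    ((∀ n : ℕ, 1 < n →
        ∑ k ∈ Finset.range n,
            (12 * (k : ℤ) ^ 4 + 25 * (k : ℤ) ^ 3 + 21 * (k : ℤ) ^ 2 + 6 * (k : ℤ))
              * (-1) ^ k * franel k
          ≡ 0 [ZMOD 4 * (n : ℤ) ^ 2 * ((n : ℤ) - 1)]) ∧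
      (∀ p : ℕ, p.Prime → Odd p →
        ∑ k ∈ Finset.range p,
            (12 * (k : ℤ) ^ 4 + 25 * (k : ℤ) ^ 3 + 21 * (k : ℤ) ^ 2 + 6 * (k : ℤ))
              * (-1) ^ k * franel k
          ≡ -4 * (p : ℤ) ^ 3 [ZMOD (p : ℤ) ^ 4])) ∧
    -- (ii)
    ((∀ n : ℕ, 0 < n →
        ∑ k ∈ Finset.range n,
            (12 * (k : ℤ) ^ 3 + 34 * (k : ℤ) ^ 2 + 30 * (k : ℤ) + 9) * gNum k
          ≡ 0 [ZMOD 3 * (n : ℤ) ^ 3]) ∧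
      (∀ p : ℕ, p.Prime → Odd p →
        RatModEq (p ^ 4)
          ((∑ k ∈ Finset.range p,
            (12 * (k : ℤ) ^ 3 + 34 * (k : ℤ) ^ 2 + 30 * (k : ℤ) + 9) * gNum k : ℤ) : ℚ)
          (3 * (p : ℚ) ^ 3 / 2 * (1 + 3 * (legendreSym 3 (p : ℤ) : ℚ))))) ∧
    -- (iii)
    ((∀ n : ℕ, 0 < n →
        ∑ k ∈ Finset.range n,
            (18 * (k : ℤ) ^ 5 + 45 * (k : ℤ) ^ 4 + 46 * (k : ℤ) ^ 3 + 24 * (k : ℤ) ^ 2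
                + 7 * (k : ℤ) + 1)
              * (-1) ^ k * apery k
          ≡ 0 [ZMOD (n : ℤ) ^ 4]) ∧
      (∀ p : ℕ, p.Prime → 3 < p →
        ∑ k ∈ Finset.range p,
            (18 * (k : ℤ) ^ 5 + 45 * (k : ℤ) ^ 4 + 46 * (k : ℤ) ^ 3 + 24 * (k : ℤ) ^ 2
                + 7 * (k : ℤ) + 1)
              * (-1) ^ k * apery k
          ≡ -2 * (p : ℤ) ^ 4 + 3 * (p : ℤ) ^ 5 [ZMOD (p : ℤ) ^ 7])) := by
  exact ⟨⟨fun _ => sum_franel_modEq_zero, fun _ => sum_franel_prime_modEq⟩,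
    ⟨fun _ => sum_gNum_modEq_zero, fun _ => sum_gNum_prime_ratModEq⟩,
    ⟨fun _ => sum_apery_modEq_zero, fun _ => sum_apery_prime_modEq⟩⟩
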